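/- Let $\mathcal H$ be a complex Hilbert space with an orthonormal basis $\{|n\rangle : n\in\mathbb N\}$, $\mathbb N=\{0,1,2,\dots\}$, and let $B(\mathcal H)$ be the algebra of bounded operators on $\mathcal H$. Let $\mathbb T=\{t\in\mathbb C:|t|=1\}$, let $dt$ be the Haar measure on $\mathbb T$ normalized to total mass $1$, and let $U$ be the number representation of $\mathbb T$ on $\mathcal H$, i.e. $U(t)|n\rangle=t^n|n\rangle$ for all $n\in\mathbb N$. Let $\Xi:B(\mathcal H)\to B(\mathcal H)$ be a normal completely positive linear map with $\Xi(I)=I$ such that $$\Xi(U(t)AU(t)^*)=U(t)\,\Xi(A)\,U(t)^*\qquad\text{for all } t\in\mathbb T,\ A\in B(\mathcal H).$$ Then there exists a sequence $(\phi_i)_{i\in\mathbb N}$ of vectors in the Hilbert space tensor product $\mathcal H\otimes\mathcal H$ with $\|\phi_i\|=1$ for all $i$, such that for all $A\in B(\mathcal H)$ and all $i,j\in\mathbb N$ the function $t\mapsto t^{i-j}\langle\phi_j|(I\otimes U(t)AU(t)^*)\phi_i\rangle$ is integrable on $\mathbb T$ and $$\langle j|\Xi(A)|i\rangle=\int_{\mathbb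 T} t^{i-j}\,\langle\phi_j|(I\otimes U(t)AU(t)^*)\phi_i\rangle\,dt .$$ (Inner products are linear in the second argument. A completely positive map is called normal if it preserves suprema of bounded upward directed families of self-adjoint operators.) -/

import Mathlib

open MeasureTheory
open scoped InnerProductSpace CStarAlgebra TensorProduct

noncomputable section

namespace PhaseChannel

set_option linter.unusedSectionVars false

variable {H : Type*} [NormedAddCommGroup H] [InnerProductSpace ℂ H] [CompleteSpace H]

/-- The vectors `t ^ n • |n⟩` form an orthonormal family. -/
theorem orthonormal_smul (b : HilbertBasis ℕ ℂ H) (t : Circle) :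
    Orthonormal ℂ (fun n : ℕ => ((t : ℂ) ^ n) • b n) := by
  rw [orthonormal_iff_ite]
  intro i j
  rw [inner_smul_left, inner_smul_right, (orthonormal_iff_ite.mp b.orthonormal) i j]
  by_cases h : i = j
  · subst h
    have h1 : (starRingEnd ℂ) ((t : ℂ) ^ i) * ((t : ℂ) ^ i) = 1 := by
      rw [← Complex.normSq_eq_conj_mul_self, Complex.normSq_eq_norm_sq, norm_pow, Circle.norm_coe]
      simp
    simpa using h1
  · simp [h]

/-- The vectors `t ^ n • |n⟩` span a dense subspace. -/
theorem dense_smul (b : HilbertBasis ℕ ℂ H) (t : Circle) :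
    ⊤ ≤ (Submodule.span ℂ
      (Set.range (fun n : ℕ => ((t : ℂ) ^ n) • b n))).topologicalClosure := by
  rw [← b.dense_span]
  apply Submodule.topologicalClosure_mono
  rw [Submodule.span_le]
  rintro _ ⟨n, rfl⟩
  have hne : ((t : ℂ) ^ n) ≠ 0 := pow_ne_zero _ t.coe_ne_zero
  have h : ((t : ℂ) ^ n)⁻¹ • (((t : ℂ) ^ n) • b n) ∈ Submodule.span ℂ
      (Set.range (fun n : ℕ => ((t : ℂ) ^ n) • b n)) :=
    Submodule.smul_mem _ _ (Submodule.subset_span ⟨n, rfl⟩)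
  rwa [smul_smul, inv_mul_cancel₀ hne, one_smul] at h

/-- The unitary operator `U(t)` on `H` with `U(t) |n⟩ = t ^ n |n⟩`, where `|n⟩ = b n`: it
carries the orthonormal basis `|n⟩` to the orthonormal basis `t ^ n |n⟩`. -/
def numberRepEquiv (b : HilbertBasis ℕ ℂ H) (t : Circle) : H ≃ₗᵢ[ℂ] H :=
  b.repr.trans (HilbertBasis.mk (orthonormal_smul b t) (dense_smul b t)).repr.symm

theorem numberRepEquiv_apply (b : HilbertBasis ℕ ℂ H) (t : Circle) (n : ℕ) :
    numberRepEquiv b t (b n) = ((t : ℂ) ^ n) • b n := by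
  classical
  simp [numberRepEquiv, HilbertBasis.repr_self, HilbertBasis.repr_symm_single]

/-- A linear isometry equivalence is determined by its values on a Hilbert basis. -/
theorem equiv_ext (b : HilbertBasis ℕ ℂ H) {V W : H ≃ₗᵢ[ℂ] H}
    (h : ∀ n, V (b n) = W (b n)) : V = W := by
  have hd : Dense (Submodule.span ℂ (Set.range b) : Set H) := by
    rw [Submodule.dense_iff_topologicalClosure_eq_top]
    exact b.dense_span
  have : (V : H →L[ℂ] H) = (W : H →L[ℂ] H) := by
    apply ContinuousLinearMap.ext_on hd
    rintro _ ⟨n, rfl⟩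
    exact h n
  ext x
  exact congrArg (fun f : H →L[ℂ] H => f x) this

/-- The number representation of the circle group `𝕋`: the homomorphism `t ↦ U(t)` into the
unitary group of `H` with `U(t) |n⟩ = t ^ n |n⟩`. -/
def numberRep (b : HilbertBasis ℕ ℂ H) : Circle →* unitary (H →L[ℂ] H) :=
  (Unitary.linearIsometryEquiv (𝕜 := ℂ) (H := H)).symm.toMonoidHom.comp
    { toFun := numberRepEquiv b
      map_one' := equiv_ext b fun n => by simp [numberRepEquiv_apply]
      map_mul' := fun s t => equiv_ext b fun n => by
        simp [numberRepEquiv_apply, mul_pow, smul_smul, mul_comm] }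

theorem numberRep_apply (b : HilbertBasis ℕ ℂ H) (t : Circle) (n : ℕ) :
    (numberRep b t : H →L[ℂ] H) (b n) = ((t : ℂ) ^ n) • b n :=
  numberRepEquiv_apply b t n

/-- Conjugation `A ↦ U(t) A U(t)*` by the number representation. -/
def conj (b : HilbertBasis ℕ ℂ H) (t : Circle) (A : H →L[ℂ] H) : H →L[ℂ] H :=
  (numberRep b t : H →L[ℂ] H) * A * star (numberRep b t : H →L[ℂ] H)

/-- A map on bounded operators is normal if it preserves the least upper bound of every bounded
upward directed set of self-adjoint operators. -/
def IsNormal (f : (H →L[ℂ] H) → (H →L[ℂ] H)) : Prop :=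
  ∀ S : Set (H →L[ℂ] H), S.Nonempty → DirectedOn (· ≤ ·) S → (∀ A ∈ S, IsSelfAdjoint A) →
    ∀ B : H →L[ℂ] H, IsLUB S B → IsLUB (f '' S) (f B)

/-- Covariance under the number representation. -/
def IsCovariant (b : HilbertBasis ℕ ℂ H) (f : (H →L[ℂ] H) → (H →L[ℂ] H)) : Prop :=
  ∀ (t : Circle) (A : H →L[ℂ] H), f (conj b t A) = conj b t (f A)

/-- The Hilbert space tensor product: the completion of the algebraic tensor product with
respect to its inner product. -/
abbrev HilbertTensor (E F : Type*) [NormedAddCommGroup E] [InnerProductSpace ℂ E]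
    [NormedAddCommGroup F] [InnerProductSpace ℂ F] : Type _ :=
  UniformSpace.Completion (E ⊗[ℂ] F)

/-- The bounded operator `I ⊗ A` on the Hilbert space tensor product. -/
def idTensor (A : H →L[ℂ] H) : HilbertTensor H H →L[ℂ] HilbertTensor H H :=
  (A.lTensor H).completion

theorem idTensor_tmul (A : H →L[ℂ] H) (x y : H) :
    idTensor A ((x ⊗ₜ[ℂ] y : H ⊗[ℂ] H) : HilbertTensor H H) =
      ((x ⊗ₜ[ℂ] A y : H ⊗[ℂ] H) : HilbertTensor H H) := by
  simp [idTensor]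

instance instMeasurableSpaceCircle : MeasurableSpace Circle := borel Circle
instance instBorelSpaceCircle : BorelSpace Circle := ⟨rfl⟩

/-- The Haar measure of the circle group, of total mass `1`. -/
def haarCircle : Measure Circle := Measure.haarMeasure ⊤

theorem haarCircle_univ : haarCircle Set.univ = 1 := by
  simpa [haarCircle] using
    (Measure.haarMeasure_self (K₀ := (⊤ : TopologicalSpace.PositiveCompacts Circle)))

end PhaseChannel

end

namespace PhaseChannel
open Filter Topology
open scoped ComplexOrder

set_option linter.unusedSectionVars false

-- Gram representation of the kernel `Ξ (star A * B)`.

universe u v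

/-! It suffices to find φ_i with ⟨φ_j|(I⊗A)φ_i⟩ = ⟨j|Ξ(A)|i⟩ for all A: covariance then makes the
integrand constant in t, and A = I gives the norms. Complete positivity makes (A,B) ↦ Ξ(A*B) a
positive kernel, so Ξ(A*B) = V(A)*V(B) for operators V(A) into some Hilbert space. The vectors
V(|0⟩⟨n|)|i⟩ are countably many, so their Gram matrix is realized by vectors w(n,i) in H; put φ_i =
Σ_n w(n,i) ⊗ |n⟩. The formula for truncations P_M A P_N is then a finite computation
(`exists_tensor_vectors`), and normality, through Ξ(P_N) → Ξ(1) strongly, removes the truncations.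
-/

/-- Every positive semidefinite operator-valued kernel is the Gram kernel of a family of bounded
operators into some Hilbert space. -/
theorem exists_operators_of_posSemidef {X : Type u} {H : Type v} [NormedAddCommGroup H]
    [InnerProductSpace ℂ H] [CompleteSpace H] {K : Matrix X X (H →L[ℂ] H)}
    (hK : K.PosSemidef) :
    ∃ (G : Type (max u v)) (_ : NormedAddCommGroup G) (_ : InnerProductSpace ℂ G) (_ : CompleteSpace G)
      (V : X → H →L[ℂ] G), ∀ x y u v, ⟪V x u, V y v⟫_ℂ = ⟪u, K x y v⟫_ℂ := by
  have : Fact K.PosSemidef := ⟨hK⟩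
  refine ⟨RKHS.OfKernel K, inferInstance, inferInstance, inferInstance,
    fun x => RKHS.kerFun (RKHS.OfKernel K) x, fun x y u v => ?_⟩
  have h := RKHS.kernel_inner (H := RKHS.OfKernel K) x y v u
  rw [RKHS.OfKernel.kernel_ofKernel] at h
  rw [← inner_conj_symm, ← h, inner_conj_symm]

variable {H : Type*} [NormedAddCommGroup H] [InnerProductSpace ℂ H] [CompleteSpace H]

theorem exists_eq_star_mul_self {A : Type*} [NonUnitalCStarAlgebra A] [PartialOrder A]
    [StarOrderedRing A] {a : A} (ha : 0 ≤ a) : ∃ c, a = star c * c :=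
  CStarAlgebra.nonneg_iff_eq_star_mul_self.mp ha

/-- Writing M = N*N turns the form into Σ_k ‖Σ_i N_ki x_i‖². -/
theorem re_sum_inner_nonneg_of_nonneg {n : Type*} [Fintype n]
    {M : CStarMatrix n n (H →L[ℂ] H)} (hM : 0 ≤ M) (x : n → H) :
    0 ≤ (∑ i, ∑ j, ⟪x i, M i j (x j)⟫_ℂ).re := by
  obtain ⟨N, rfl⟩ := exists_eq_star_mul_self hM
  have key : ∑ i, ∑ j, ⟪x i, (star N * N) i j (x j)⟫_ℂ =
      ∑ k, ⟪∑ i, N k i (x i), ∑ j, N k j (x j)⟫_ℂ := by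
    simp only [CStarMatrix.mul_apply, CStarMatrix.star_apply, FunLike.coe_sum, Finset.sum_apply,
      inner_sum, sum_inner, mul_apply_eq_comp, ContinuousLinearMap.star_eq_adjoint,
      ContinuousLinearMap.adjoint_inner_right]
    rw [Finset.sum_comm]
    rw [Finset.sum_congr rfl fun _ _ => Finset.sum_comm, Finset.sum_comm]
  rw [key, Complex.re_sum]
  exact Finset.sum_nonneg fun k _ => inner_self_nonneg (𝕜 := ℂ)

theorem map_star_cp (Ξ : (H →L[ℂ] H) →CP (H →L[ℂ] H)) (A : H →L[ℂ] H) :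
    Ξ (star A) = star (Ξ A) := map_star Ξ A

theorem posSemidef_star_mul (Ξ : (H →L[ℂ] H) →CP (H →L[ℂ] H)) :
    (Matrix.of fun a b : H →L[ℂ] H => Ξ (star a * b)).PosSemidef := by
  have h := (RKHS.posSemidef_tfae (𝕜 := ℂ) (V := H)
    (K := Matrix.of fun a b : H →L[ℂ] H => Ξ (star a * b))).out 0 2
  refine h.mpr ⟨?_, fun v => ?_⟩
  · ext1 a b
    simp [Matrix.conjTranspose_apply, ← map_star]
  · rcases v.support.eq_empty_or_nonempty with h | ⟨k, hk⟩
    · simp [Finsupp.support_eq_empty.mp h]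
    · classical
      -- R has one nonzero row, listing the operators in the support, so R*R has entries a*b.
      let R : CStarMatrix v.support v.support (H →L[ℂ] H) :=
        CStarMatrix.ofMatrix fun i j => if i = ⟨k, hk⟩ then (j : H →L[ℂ] H) else 0
      have hRk : ∀ j, R ⟨k, hk⟩ j = j := fun j => if_pos rfl
      have hRz : ∀ l j, l ≠ ⟨k, hk⟩ → R l j = 0 := fun l j hl => if_neg hl
      have hR := re_sum_inner_nonneg_of_nonneg
        (Ξ.map_cstarMatrix_nonneg _ (star_mul_self_nonneg R)) fun i => v i
      have hent : ∀ i j, (star R * R) i j = star (i : H →L[ℂ] H) * j := by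
        intro i j
        rw [CStarMatrix.mul_apply, Finset.sum_eq_single ⟨k, hk⟩]
        · rw [CStarMatrix.star_apply, hRk, hRk]
        · intro l _ hl
          rw [hRz l j hl, mul_zero]
        · simp
      simp only [CStarMatrix.map_apply, hent] at hR
      rw [← Complex.conj_re, map_sum] at hR
      simp only [map_sum, inner_conj_symm] at hR
      simp only [Finsupp.sum]
      rw [← Finset.sum_coe_sort, Finset.sum_comm]
      simpa [← Finset.sum_coe_sort v.support] using hR

/-! ### Moving a countable Gram matrix into H. -/

/-- An orthonormal set in a separable inner product space is countable. -/
theorem countable_of_orthonormal {G : Type*} [NormedAddCommGroup G] [InnerProductSpace ℂ G]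
    [TopologicalSpace.SeparableSpace G] {ι : Type*} {e : ι → G} (he : Orthonormal ℂ e) :
    Countable ι := by
  refine Pairwise.countable_of_isOpen_disjoint (s := fun i => Metric.ball (e i) (1 / 2))
    (fun i j hij => ?_) (fun i => Metric.isOpen_ball)
    (fun i => ⟨e i, Metric.mem_ball_self (by norm_num)⟩)
  refine Metric.ball_disjoint_ball ?_
  have h : ‖e i - e j‖ ^ 2 = 2 := by
    rw [@norm_sub_sq ℂ, he.1 i, he.1 j, he.2 hij]
    norm_num
  rw [dist_eq_norm]
  nlinarith [norm_nonneg (e i - e j)]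

/-- The Gram matrix of a countable family of vectors in a Hilbert space is realized in every
infinite-dimensional Hilbert space. -/
theorem exists_inner_eq_of_countable {H : Type*} [NormedAddCommGroup H] [InnerProductSpace ℂ H]
    [CompleteSpace H] (b : HilbertBasis ℕ ℂ H) {G : Type*} [NormedAddCommGroup G]
    [InnerProductSpace ℂ G] [CompleteSpace G] {ι : Type*} [Countable ι] (v : ι → G) :
    ∃ w : ι → H, ∀ i j, ⟪w i, w j⟫_ℂ = ⟪v i, v j⟫_ℂ := by
  let S : Submodule ℂ G := (Submodule.span ℂ (Set.range v)).topologicalClosure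
  have hS : IsClosed (S : Set G) := Submodule.isClosed_topologicalClosure _
  have : CompleteSpace S := hS.completeSpace_coe
  have hsep : TopologicalSpace.SeparableSpace S := by
    have h1 : TopologicalSpace.IsSeparable (Set.range v) :=
      (Set.countable_range v).isSeparable
    have h2 : TopologicalSpace.IsSeparable (S : Set G) := (h1.span (R := ℂ)).closure
    exact h2.separableSpace
  obtain ⟨s, e, he⟩ := exists_hilbertBasis ℂ S
  have : Countable s := countable_of_orthonormal e.orthonormal
  obtain ⟨f, hf⟩ := exists_injective_nat s
  have hb : Orthonormal ℂ (b ∘ f) := b.orthonormal.comp f hf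
  -- The closed span is separable, so its Hilbert basis is countable and can be sent injectively
  -- into `b`.
  let J : S →ₗᵢ[ℂ] H :=
    hb.orthogonalFamily.linearIsometry.comp e.repr.toLinearIsometry
  have hv : ∀ i, v i ∈ S := fun i =>
    Submodule.le_topologicalClosure _ (Submodule.subset_span ⟨i, rfl⟩)
  refine ⟨fun i => J ⟨v i, hv i⟩, fun i j => ?_⟩
  rw [J.inner_map_map]
  rfl

/-! ### Monotone sequences of operators. -/

/-- With S = R*R, ‖Sy‖² ≤ ‖R‖²‖Ry‖². This upgrades convergence of quadratic forms to strong
convergence. -/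
theorem norm_apply_sq_le_of_nonneg {S : H →L[ℂ] H} (hS : 0 ≤ S) (y : H) :
    ‖S y‖ ^ 2 ≤ ‖S‖ * (⟪y, S y⟫_ℂ).re := by
  obtain ⟨R, rfl⟩ := exists_eq_star_mul_self hS
  have h1 : (⟪y, (star R * R) y⟫_ℂ).re = ‖R y‖ ^ 2 := by
    rw [mul_apply_eq_comp, ContinuousLinearMap.star_eq_adjoint,
      ContinuousLinearMap.adjoint_inner_right]
    exact inner_self_eq_norm_sq (𝕜 := ℂ) (R y)
  have h2 : ‖(star R * R) y‖ ≤ ‖R‖ * ‖R y‖ := by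
    have := (star R).le_opNorm (R y)
    rwa [norm_star] at this
  rw [h1, CStarRing.norm_star_mul_self]
  calc ‖(star R * R) y‖ ^ 2 ≤ (‖R‖ * ‖R y‖) ^ 2 := by gcongr
    _ = _ := by ring

/-- The order on ℂ forces equal imaginary parts, so S and T need not be self-adjoint. -/
theorem le_iff_inner {S T : H →L[ℂ] H} :
    S ≤ T ↔ ∀ y, ⟪y, S y⟫_ℂ ≤ ⟪y, T y⟫_ℂ := by
  rw [ContinuousLinearMap.le_def, ContinuousLinearMap.isPositive_iff_complex]
  refine forall_congr' fun y => ?_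
  have h : ⟪y, T y⟫_ℂ - ⟪y, S y⟫_ℂ = (starRingEnd ℂ) ⟪(T - S) y, y⟫_ℂ := by
    rw [inner_conj_symm, sub_apply, inner_sub_right]
  rw [← sub_nonneg (b := ⟪y, S y⟫_ℂ), h]
  generalize ⟪(T - S) y, y⟫_ℂ = z
  simp [Complex.ext_iff, Complex.le_def, and_comm, eq_comm]

/-- A bounded monotone sequence of operators converges strongly to its least upper bound. -/
theorem tendsto_apply_of_isLUB {T : ℕ → H →L[ℂ] H} (hT : Monotone T) {B : H →L[ℂ] H}
    (hB : IsLUB (Set.range T) B) (y : H) : Tendsto (fun n => T n y) atTop (𝓝 (B y)) := by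
  have hle : ∀ n, T n ≤ B := fun n => hB.1 ⟨n, rfl⟩
  have hcauchy : ∀ z, CauchySeq fun n => T n z := by
    intro z
    have hmono : Monotone fun n => (⟪z, T n z⟫_ℂ).re := fun m n hmn =>
      (Complex.le_def.mp (le_iff_inner.mp (hT hmn) z)).1
    have hbdd : BddAbove (Set.range fun n => (⟪z, T n z⟫_ℂ).re) :=
      ⟨(⟪z, B z⟫_ℂ).re, by
        rintro _ ⟨n, rfl⟩
        exact (Complex.le_def.mp (le_iff_inner.mp (hle n) z)).1⟩
    have hlim := tendsto_atTop_ciSup hmono hbdd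
    set l := ⨆ n, (⟪z, T n z⟫_ℂ).re
    have hl : ∀ n, (⟪z, T n z⟫_ℂ).re ≤ l := fun n => le_ciSup hbdd n
    have hest : ∀ N n, N ≤ n →
        ‖T n z - T N z‖ ≤ √(‖B - T 0‖ * (l - (⟪z, T N z⟫_ℂ).re)) := by
      intro N n hNn
      refine Real.le_sqrt_of_sq_le ?_
      have h0 : 0 ≤ T n - T N := sub_nonneg.mpr (hT hNn)
      have h1 : T n - T N ≤ B - T 0 := sub_le_sub (hle n) (hT (Nat.zero_le N))
      have h2 := norm_apply_sq_le_of_nonneg h0 z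
      rw [sub_apply, inner_sub_right, Complex.sub_re] at h2
      refine h2.trans (mul_le_mul (CStarAlgebra.norm_le_norm_of_nonneg_of_le h0 h1) ?_ ?_ ?_)
      · linarith [hl n]
      · linarith [hmono hNn]
      · positivity
    refine cauchySeq_of_le_tendsto_0'
      (fun N => √(‖B - T 0‖ * (l - (⟪z, T N z⟫_ℂ).re))) (fun N n hNn => ?_) ?_
    · rw [dist_comm, dist_eq_norm]
      exact hest N n hNn
    · have := ((hlim.const_sub l).const_mul ‖B - T 0‖).sqrt
      simpa using this
  choose L hL using fun z => cauchySeq_tendsto_of_complete (hcauchy z)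
  let C : H →L[ℂ] H := continuousLinearMapOfTendsto T (tendsto_pi_nhds.mpr hL)
  have hC : ∀ z, C z = L z := fun z => rfl
  -- The strong limit C is an upper bound lying below B, hence equals B.
  have hCle : C ≤ B := le_iff_inner.mpr fun z =>
    le_of_tendsto (tendsto_const_nhds.inner (hL z))
      (Eventually.of_forall fun n => le_iff_inner.mp (hle n) z)
  have hBC : B ≤ C := hB.2 <| by
    rintro _ ⟨n, rfl⟩
    exact le_iff_inner.mpr fun z => ge_of_tendsto (tendsto_const_nhds.inner (hL z))
      ((eventually_ge_atTop n).mono fun m hm => le_iff_inner.mp (hT hm) z)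
  rw [le_antisymm hBC hCle]
  exact hL y

/-! ### Basis projections and normality. -/

/-- The orthogonal projection onto the span of the first `N` basis vectors. -/
noncomputable def basisProj (b : HilbertBasis ℕ ℂ H) (N : ℕ) : H →L[ℂ] H :=
  ∑ n ∈ Finset.range N, InnerProductSpace.rankOne ℂ (b n) (b n)

theorem basisProj_apply (b : HilbertBasis ℕ ℂ H) (N : ℕ) (x : H) :
    basisProj b N x = ∑ n ∈ Finset.range N, ⟪b n, x⟫_ℂ • b n := by
  simp [basisProj]

theorem tendsto_basisProj_apply (b : HilbertBasis ℕ ℂ H) (x : H) :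
    Tendsto (fun N => basisProj b N x) atTop (𝓝 x) := by
  simp only [basisProj_apply]
  simpa [HilbertBasis.repr_apply_apply] using (b.hasSum_repr x).tendsto_sum_nat

theorem monotone_basisProj (b : HilbertBasis ℕ ℂ H) : Monotone (basisProj b) := by
  refine monotone_nat_of_le_succ fun N => ?_
  rw [basisProj, basisProj, Finset.sum_range_succ]
  exact le_add_of_nonneg_right ((ContinuousLinearMap.nonneg_iff_isPositive _).mpr
    (InnerProductSpace.isPositive_rankOne_self _))

theorem isSelfAdjoint_basisProj (b : HilbertBasis ℕ ℂ H) (N : ℕ) :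
    IsSelfAdjoint (basisProj b N) :=
  isSelfAdjoint_sum _ fun _ _ => (InnerProductSpace.isPositive_rankOne_self _).isSelfAdjoint

theorem basisProj_mul_self (b : HilbertBasis ℕ ℂ H) (N : ℕ) :
    basisProj b N * basisProj b N = basisProj b N := by
  ext x
  rw [mul_apply_eq_comp, basisProj_apply b N x, map_sum]
  refine Finset.sum_congr rfl fun n hn => ?_
  rw [map_smul, basisProj_apply, Finset.sum_eq_single n]
  · simp [b.orthonormal.1 n]
  · intro m _ hm
    simp [b.orthonormal.2 hm]
  · exact fun h => absurd hn h

theorem star_mul_self_one_sub_basisProj (b : HilbertBasis ℕ ℂ H) (N : ℕ) :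
    star (1 - basisProj b N) * (1 - basisProj b N) = 1 - basisProj b N := by
  rw [star_sub, star_one, (isSelfAdjoint_basisProj b N).star_eq, mul_sub, sub_mul, sub_mul,
    basisProj_mul_self]
  simp

theorem isLUB_basisProj (b : HilbertBasis ℕ ℂ H) : IsLUB (Set.range (basisProj b)) 1 := by
  have hlim : ∀ y, Tendsto (fun N => ⟪y, basisProj b N y⟫_ℂ) atTop (𝓝 ⟪y, y⟫_ℂ) := fun y =>
    tendsto_const_nhds.inner (tendsto_basisProj_apply b y)
  constructor
  · rintro _ ⟨n, rfl⟩
    exact le_iff_inner.mpr fun y => ge_of_tendsto (hlim y)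
      ((eventually_ge_atTop n).mono fun m hm => le_iff_inner.mp (monotone_basisProj b hm) y)
  · intro C hC
    exact le_iff_inner.mpr fun y => le_of_tendsto (hlim y)
      (Eventually.of_forall fun n => le_iff_inner.mp (hC ⟨n, rfl⟩) y)

theorem monotone_cp (Ξ : (H →L[ℂ] H) →CP (H →L[ℂ] H)) : Monotone Ξ := OrderHomClass.mono Ξ

theorem IsNormal.tendsto_basisProj {Ξ : (H →L[ℂ] H) →CP (H →L[ℂ] H)} (hΞ : IsNormal Ξ)
    (b : HilbertBasis ℕ ℂ H) (y : H) :
    Tendsto (fun N => Ξ (basisProj b N) y) atTop (𝓝 (Ξ 1 y)) := by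
  refine tendsto_apply_of_isLUB (T := fun N => Ξ (basisProj b N))
    ((monotone_cp Ξ).comp (monotone_basisProj b)) ?_ y
  have h := hΞ (Set.range (basisProj b)) (Set.range_nonempty _)
    (monotone_basisProj b).directed_le.directedOn_range
    (by rintro _ ⟨n, rfl⟩; exact isSelfAdjoint_basisProj b n) 1 (isLUB_basisProj b)
  rwa [← Set.range_comp] at h

/-! ### Vectors in the tensor product. -/

/-- The embedding `x ↦ x ⊗ |n⟩`. -/
noncomputable def tensorBasis (b : HilbertBasis ℕ ℂ H) (n : ℕ) : H →ₗᵢ[ℂ] HilbertTensor H H where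
  toFun x := ((x ⊗ₜ[ℂ] b n : H ⊗[ℂ] H) : HilbertTensor H H)
  map_add' x y := by rw [TensorProduct.add_tmul, UniformSpace.Completion.coe_add]
  map_smul' c x := by
    rw [← TensorProduct.smul_tmul', UniformSpace.Completion.coe_smul, RingHom.id_apply]
  norm_map' x := by simp [b.orthonormal.1 n]

theorem inner_tensorBasis_idTensor (b : HilbertBasis ℕ ℂ H) (A : H →L[ℂ] H) (m n : ℕ) (x y : H) :
    ⟪tensorBasis b m y, idTensor A (tensorBasis b n x)⟫_ℂ = ⟪b m, A (b n)⟫_ℂ * ⟪y, x⟫_ℂ := by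
  change ⟪((y ⊗ₜ[ℂ] b m : H ⊗[ℂ] H) : HilbertTensor H H),
    idTensor A ((x ⊗ₜ[ℂ] b n : H ⊗[ℂ] H) : HilbertTensor H H)⟫_ℂ = _
  rw [idTensor_tmul, UniformSpace.Completion.inner_coe, TensorProduct.inner_tmul, mul_comm]

theorem orthogonalFamily_tensorBasis (b : HilbertBasis ℕ ℂ H) :
    OrthogonalFamily ℂ (fun _ : ℕ => H) (tensorBasis b) := by
  intro m n hmn y x
  change ⟪((y ⊗ₜ[ℂ] b m : H ⊗[ℂ] H) : HilbertTensor H H),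
    ((x ⊗ₜ[ℂ] b n : H ⊗[ℂ] H) : HilbertTensor H H)⟫_ℂ = 0
  rw [UniformSpace.Completion.inner_coe, TensorProduct.inner_tmul, b.orthonormal.2 hmn, mul_zero]

theorem basisProj_mul_mul_basisProj (b : HilbertBasis ℕ ℂ H) (A : H →L[ℂ] H) (M N : ℕ) :
    basisProj b M * A * basisProj b N = ∑ m ∈ Finset.range M, ∑ n ∈ Finset.range N,
      ⟪b m, A (b n)⟫_ℂ • InnerProductSpace.rankOne ℂ (b m) (b n) := by
  ext x
  simp only [mul_apply_eq_comp, basisProj_apply, map_sum, map_smul, FunLike.coe_sum,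
    Finset.sum_apply, smul_apply, InnerProductSpace.rankOne_apply, Finset.smul_sum, smul_smul]
  rw [Finset.sum_comm]
  simp only [mul_comm]

theorem star_rankOne_mul_rankOne (b : HilbertBasis ℕ ℂ H) (k m n : ℕ) :
    star (InnerProductSpace.rankOne ℂ (b k) (b m)) * InnerProductSpace.rankOne ℂ (b k) (b n) =
      InnerProductSpace.rankOne ℂ (b m) (b n) := by
  rw [ContinuousLinearMap.star_eq_adjoint, InnerProductSpace.adjoint_rankOne,
    ContinuousLinearMap.mul_def, InnerProductSpace.rankOne_comp_rankOne]
  simp [b.orthonormal.1 k]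

/-- A normal completely positive map is a compression of `A ↦ I ⊗ A`. -/
theorem exists_tensor_vectors (b : HilbertBasis ℕ ℂ H) {Ξ : (H →L[ℂ] H) →CP (H →L[ℂ] H)}
    (hΞ : IsNormal Ξ) : ∃ φ : ℕ → HilbertTensor H H, ∀ (A : H →L[ℂ] H) (i j : ℕ),
      ⟪φ j, idTensor A (φ i)⟫_ℂ = ⟪b j, Ξ A (b i)⟫_ℂ := by
  obtain ⟨G, _, _, _, V, hV⟩ := exists_operators_of_posSemidef (posSemidef_star_mul Ξ)
  simp only [Matrix.of_apply] at hV
  -- The index 0 is arbitrary: (|0⟩⟨m|)*|0⟩⟨n| = |m⟩⟨n|, so the Gram entries are ⟨j|Ξ(|m⟩⟨n|)|i⟩.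
  obtain ⟨w, hw⟩ := exists_inner_eq_of_countable b fun p : ℕ × ℕ =>
    V (InnerProductSpace.rankOne ℂ (b 0) (b p.1)) (b p.2)
  simp only [hV, star_rankOne_mul_rankOne] at hw
  -- convergence of the compressions
  have hQ : ∀ y, Tendsto (fun N => V (1 - basisProj b N) y) atTop (𝓝 0) := by
    intro y
    have h1 : ∀ N, ‖V (1 - basisProj b N) y‖ ^ 2 =
        (⟪y, Ξ 1 y - Ξ (basisProj b N) y⟫_ℂ).re := by
      intro N
      have h := hV (1 - basisProj b N) (1 - basisProj b N) y y
      rw [star_mul_self_one_sub_basisProj] at h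
      rw [← sub_apply, ← map_sub, ← h]
      exact (inner_self_eq_norm_sq (𝕜 := ℂ) (V (1 - basisProj b N) y)).symm
    have h2 : Tendsto (fun N => ‖V (1 - basisProj b N) y‖ ^ 2) atTop (𝓝 0) := by
      simp only [h1]
      have h3 := (hΞ.tendsto_basisProj b y).const_sub (Ξ 1 y)
      have h4 := (Complex.continuous_re.tendsto _).comp
        ((tendsto_const_nhds (x := y)).inner h3 (𝕜 := ℂ))
      simpa [Function.comp_def, inner_sub_right] using h4
    rw [tendsto_zero_iff_norm_tendsto_zero]
    simpa using h2.sqrt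
  have hright : ∀ (B : H →L[ℂ] H) (x y : H),
      Tendsto (fun N => ⟪x, Ξ (B * basisProj b N) y⟫_ℂ) atTop (𝓝 ⟪x, Ξ B y⟫_ℂ) := by
    intro B x y
    -- The error Ξ(B(1 - P_N)) factors through V(B*) and V(1 - P_N), and the latter tends strongly
    -- to 0.
    have h1 : ∀ N, ⟪x, Ξ (B * basisProj b N) y⟫_ℂ =
        ⟪x, Ξ B y⟫_ℂ - ⟪V (star B) x, V (1 - basisProj b N) y⟫_ℂ := by
      intro N
      rw [hV, star_star, mul_sub, mul_one, map_sub, sub_apply, inner_sub_right, sub_sub_cancel]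
    simp only [h1]
    simpa using ((tendsto_const_nhds (x := V (star B) x)).inner (hQ y) (𝕜 := ℂ)).const_sub
      ⟪x, Ξ B y⟫_ℂ
  have hleft : ∀ (B : H →L[ℂ] H) (x y : H),
      Tendsto (fun N => ⟪x, Ξ (basisProj b N * B) y⟫_ℂ) atTop (𝓝 ⟪x, Ξ B y⟫_ℂ) := by
    intro B x y
    have h1 : ∀ C : H →L[ℂ] H, ⟪x, Ξ C y⟫_ℂ = (starRingEnd ℂ) ⟪y, Ξ (star C) x⟫_ℂ := by
      intro C
      rw [map_star_cp, ContinuousLinearMap.star_eq_adjoint, ContinuousLinearMap.adjoint_inner_right,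
        inner_conj_symm]
    simp only [h1 B, h1 (_ * B), star_mul, (isSelfAdjoint_basisProj b _).star_eq]
    exact (Complex.continuous_conj.tendsto _).comp (hright (star B) y x)
  -- the vectors
  have hsum : ∀ i, Summable fun n => tensorBasis b n (w (n, i)) := by
    intro i
    rw [(orthogonalFamily_tensorBasis b).summable_iff_norm_sq_summable]
    refine summable_of_sum_range_le (c := (⟪b i, Ξ 1 (b i)⟫_ℂ).re) (fun n => sq_nonneg _)
      fun N => ?_
    -- The squared norms sum to ⟨i|Ξ(P_N)|i⟩, bounded by ⟨i|Ξ(1)|i⟩.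
    have h1 : ∑ n ∈ Finset.range N, ‖w (n, i)‖ ^ 2 = (⟪b i, Ξ (basisProj b N) (b i)⟫_ℂ).re := by
      rw [basisProj, map_sum, FunLike.coe_sum, Finset.sum_apply, inner_sum, Complex.re_sum]
      refine Finset.sum_congr rfl fun n _ => ?_
      rw [← hw (n, i) (n, i)]
      exact (inner_self_eq_norm_sq (𝕜 := ℂ) _).symm
    rw [h1]
    exact (Complex.le_def.mp (le_iff_inner.mp
      (monotone_cp Ξ ((isLUB_basisProj b).1 ⟨N, rfl⟩)) (b i))).1
  refine ⟨fun i => ∑' n, tensorBasis b n (w (n, i)), fun A i j => ?_⟩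
  have hφ := fun i => (hsum i).hasSum.tendsto_sum_nat
  have hfin : ∀ M N, ⟪∑ m ∈ Finset.range M, tensorBasis b m (w (m, j)),
      idTensor A (∑ n ∈ Finset.range N, tensorBasis b n (w (n, i)))⟫_ℂ =
      ⟪b j, Ξ (basisProj b M * A * basisProj b N) (b i)⟫_ℂ := by
    intro M N
    simp only [basisProj_mul_mul_basisProj, map_sum, map_smul, FunLike.coe_sum, Finset.sum_apply,
      sum_inner, inner_sum, inner_tensorBasis_idTensor, hw, smul_apply, inner_smul_right]
    exact Finset.sum_comm
  -- Let N → ∞ with M fixed, then M → ∞; no joint limit is needed.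
  have hM : ∀ M, ⟪∑ m ∈ Finset.range M, tensorBasis b m (w (m, j)),
      idTensor A (∑' n, tensorBasis b n (w (n, i)))⟫_ℂ =
      ⟪b j, Ξ (basisProj b M * A) (b i)⟫_ℂ := by
    intro M
    refine tendsto_nhds_unique (tendsto_const_nhds.inner
      (((idTensor A).continuous.tendsto _).comp (hφ i))) ?_
    simpa only [Function.comp_apply, hfin] using hright (basisProj b M * A) (b j) (b i)
  refine tendsto_nhds_unique ((hφ j).inner tendsto_const_nhds) ?_
  simpa only [hM] using hleft A (b j) (b i)

/-! ### Phases under the number representation. -/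

theorem star_numberRep_apply (b : HilbertBasis ℕ ℂ H) (t : Circle) (n : ℕ) :
    star (numberRep b t : H →L[ℂ] H) (b n) = ((t : ℂ) ^ (-(n : ℤ))) • b n := by
  have h1 : star (numberRep b t : H →L[ℂ] H) ((numberRep b t : H →L[ℂ] H) (b n)) = b n := by
    rw [← mul_apply_eq_comp, Unitary.coe_star_mul_self]
    rfl
  rw [numberRep_apply, map_smul] at h1
  rw [← h1, smul_smul, zpow_neg, zpow_natCast, inv_mul_cancel₀ (pow_ne_zero _ t.coe_ne_zero),
    one_smul, h1]

theorem inner_conj_apply (b : HilbertBasis ℕ ℂ H) (t : Circle) (A : H →L[ℂ] H) (i j : ℕ) :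
    ⟪b j, conj b t A (b i)⟫_ℂ = (t : ℂ) ^ ((j : ℤ) - (i : ℤ)) * ⟪b j, A (b i)⟫_ℂ := by
  have h2 : (numberRep b t : H →L[ℂ] H) =
      ContinuousLinearMap.adjoint (star (numberRep b t : H →L[ℂ] H)) := by
    rw [← ContinuousLinearMap.star_eq_adjoint, star_star]
  rw [conj, mul_apply_eq_comp, mul_apply_eq_comp, star_numberRep_apply]
  nth_rw 1 [h2]
  rw [ContinuousLinearMap.adjoint_inner_right, star_numberRep_apply, map_smul, inner_smul_left,
    inner_smul_right, ← mul_assoc, map_zpow₀, ← Circle.coe_inv_eq_conj, Circle.coe_inv,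
    zpow_neg, inv_zpow, inv_inv, ← zpow_add₀ t.coe_ne_zero, sub_eq_add_neg]

end PhaseChannel

theorem mainTheorem5 {H : Type*} [NormedAddCommGroup H] [InnerProductSpace ℂ H] [CompleteSpace H]
    (b : HilbertBasis ℕ ℂ H) (Ξ : (H →L[ℂ] H) →CP (H →L[ℂ] H))
    (hnormal : PhaseChannel.IsNormal Ξ) (hunital : Ξ 1 = 1)
    (hcov : PhaseChannel.IsCovariant b Ξ) :
    ∃ φ : ℕ → PhaseChannel.HilbertTensor H H, (∀ i, ‖φ i‖ = 1) ∧
      ∀ (A : H →L[ℂ] H) (i j : ℕ),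
        Integrable (fun t : Circle => (t : ℂ) ^ ((i : ℤ) - (j : ℤ)) *
          ⟪φ j, PhaseChannel.idTensor (PhaseChannel.conj b t A) (φ i)⟫_ℂ)
          PhaseChannel.haarCircle ∧
        ⟪b j, Ξ A (b i)⟫_ℂ = ∫ t : Circle, (t : ℂ) ^ ((i : ℤ) - (j : ℤ)) *
          ⟪φ j, PhaseChannel.idTensor (PhaseChannel.conj b t A) (φ i)⟫_ℂ
          ∂PhaseChannel.haarCircle := by
  obtain ⟨φ, hφ⟩ := PhaseChannel.exists_tensor_vectors b hnormal
  have : IsProbabilityMeasure PhaseChannel.haarCircle := ⟨PhaseChannel.haarCircle_univ⟩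
  refine ⟨φ, fun i => ?_, fun A i j => ?_⟩
  · have h1 : PhaseChannel.idTensor (1 : H →L[ℂ] H) (φ i) = φ i := by
      have : PhaseChannel.idTensor (1 : H →L[ℂ] H) = 1 := by
        rw [PhaseChannel.idTensor, ContinuousLinearMap.lTensor_one]
        ext x
        exact congrFun UniformSpace.Completion.map_id x
      rw [this]
      rfl
    have h2 := hφ 1 i i
    rw [h1, hunital, one_apply_eq_self, inner_self_eq_norm_sq_to_K, inner_self_eq_norm_sq_to_K,
      b.orthonormal.1 i] at h2
    have h3 : ‖φ i‖ ^ 2 = 1 ^ 2 := by exact_mod_cast h2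
    exact (sq_eq_sq₀ (norm_nonneg _) zero_le_one).mp h3
  -- By covariance the matrix element carries the phase t^(j-i), which cancels the prefactor; the
  -- constant is integrated against total mass 1.
  · have h : ∀ t : Circle, (t : ℂ) ^ ((i : ℤ) - (j : ℤ)) *
        ⟪φ j, PhaseChannel.idTensor (PhaseChannel.conj b t A) (φ i)⟫_ℂ = ⟪b j, Ξ A (b i)⟫_ℂ := by
      intro t
      rw [hφ, hcov, PhaseChannel.inner_conj_apply, ← mul_assoc, ← zpow_add₀ t.coe_ne_zero]
      simp
    simp only [h]
    exact ⟨integrable_const _, by simp⟩
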